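/- Let $M$ be a closed $3$-manifold with a triangulation $\mathcal T$ (a homeomorphism from the underlying space of a finite simplicial complex onto $M$), and let each edge of $\mathcal T$ be given an orientation. Call such a choice a *local orientation* if 1. for each vertex $v$, the maximal subgraphs $o(v)$ and $i(v)$ of the $1$-skeleton of $\mathrm{link}(v)$ whose vertices are, respectively, the vertices $w$ for which the edge $vw$ is oriented from $v$ to $w$, and those for which it is oriented from $w$ to $v$, are nonempty and connected; 2. the orientations restrict to a total ordering on the vertices of each tetrahedron of $\mathcal T$; 3. there is an oriented edge path from each vertex to each other vertex. If $a<b<c$ are the vertices of a triangle of $\mathcal T$ in the resulting order, call $ac$ its long edge, $ab$ its lower short edge and $bc$ its upper short edge. Let $\Gamma$ be the directed graph whose vertices are the edges of $\mathcal T$ and whose directed edges are the ordered pairs $(e,f)$ such that $f$ is the long edge and $e$ the upper or the lower short edge of some triangle of $\mathcal T$. Call $\Gamma$ *expanding* if there is a triangle of $\mathcal T$, with upper short edge $e_i$, lower short edge $e_j$ and long edge $e_k$, such that $(e_i,e_k)$ is contained in a directed loop of $\Gamma$ and $(e_j,e_k)$ is contained in a directed loop of $\Gamma$. Suppose that the given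 orientations form a local orientation, that every oriented loop in the $1$-skeleton (closed edge path of positive length which follows the orientations of the edges) is homotopically essential, i.e. not null-homotopic in $M$, and that $\Gamma$ is expanding. Then $\pi_1(M)$ has exponential growth: it is finitely generated, and for each finite generating set $S$ there is $c>1$ such that for every integer $n\ge 0$ the ball of radius $n$ in the word metric of $S$ has at least $c^n$ elements. -/

import Mathlib

open scoped Pointwise

open Classical in
/-- The closed ball of radius `n` about `1` in the word metric of `G` for the finite set `S`:
all products of `n` factors from `S ∪ S⁻¹ ∪ {1}`. -/
noncomputable def wordBall {G : Type*} [Group G] (S : Finset G) (n : ℕ) : Finset G :=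
  (insert 1 (S ∪ S⁻¹)) ^ n

/-- `G` is finitely generated and, with respect to every finite generating set, its balls grow
at least exponentially in the radius. -/
def HasExponentialGrowth (G : Type*) [Group G] : Prop :=
  Group.FG G ∧ ∀ S : Finset G, Subgroup.closure (S : Set G) = ⊤ →
    ∃ c : ℝ, 1 < c ∧ ∀ n : ℕ, c ^ n ≤ ((wordBall S n).card : ℝ)

/-- A (finite) triangulation of the space `M`: a finite geometric simplicial complex in a real
normed space `E`, with a homeomorphism from its underlying space onto `M`. -/
structure Triangulation (M : Type*) [TopologicalSpace M]
    (E : Type*) [NormedAddCommGroup E] [NormedSpace ℝ E] where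
  complex : Geometry.SimplicialComplex ℝ E
  finite_faces : complex.faces.Finite
  homeo : complex.space ≃ₜ M

namespace Triangulation

variable {M : Type*} [TopologicalSpace M] {E : Type*} [NormedAddCommGroup E] [NormedSpace ℝ E]

/-- The vertices of the triangulation. -/
abbrev Vertex (T : Triangulation M E) : Type _ := T.complex.vertices

/-- The point of `M` at which a vertex is located. -/
def point (T : Triangulation M E) (v : T.Vertex) : M :=
  T.homeo ⟨v.1, T.complex.vertices_subset_space v.2⟩

open Classical in
/-- The vertices `u`, `v` span a simplex (an edge if `u ≠ v`). -/
def IsEdge (T : Triangulation M E) (u v : T.Vertex) : Prop :=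
  ({u.1, v.1} : Finset E) ∈ T.complex.faces

open Classical in
/-- The vertices `u`, `v`, `w` span a simplex (a triangle if they are distinct). -/
def IsTriangle (T : Triangulation M E) (u v w : T.Vertex) : Prop :=
  ({u.1, v.1, w.1} : Finset E) ∈ T.complex.faces

theorem IsEdge.lineMap_mem {T : Triangulation M E} {u v : T.Vertex} (h : T.IsEdge u v)
    (t : unitInterval) : Path.segment u.1 v.1 t ∈ T.complex.space := by
  classical
  refine Geometry.SimplicialComplex.convexHull_subset_space h ?_
  have hmem : Path.segment u.1 v.1 t ∈ segment ℝ u.1 v.1 := by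
    rw [← Path.range_segment]
    exact Set.mem_range_self t
  simpa [convexHull_pair] using hmem

/-- The edge from `u` to `v` as a path in `M`: the image of the straight segment. -/
def IsEdge.path {T : Triangulation M E} {u v : T.Vertex} (h : T.IsEdge u v) :
    Path (T.point u) (T.point v) where
  toFun t := T.homeo ⟨Path.segment u.1 v.1 t, h.lineMap_mem t⟩
  continuous_toFun := T.homeo.continuous.comp
    ((Path.segment u.1 v.1).continuous.subtype_mk _)
  source' := by simp [point]
  target' := by simp [point]

/-- The `1`-skeleton of the link of `v`: its vertices are the `w ≠ v` such that `v`, `w` span an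
edge, and its edges are the pairs that span a triangle with `v`. -/
def linkGraph (T : Triangulation M E) (v : T.Vertex) :
    SimpleGraph {w : T.Vertex // w ≠ v ∧ T.IsEdge v w} where
  Adj a b := a ≠ b ∧ T.IsTriangle v a.1 b.1
  symm := ⟨fun a b h => ⟨h.1.symm, by
    classical
    have h2 := h.2
    unfold IsTriangle at h2 ⊢
    rwa [Finset.pair_comm b.1.1 a.1.1]⟩⟩
  loopless := ⟨fun _ h => h.1 rfl⟩

/-- A direction: a choice of orientation of each edge; `lt u v` says that `u`, `v` span an edge
which is oriented from `u` to `v`. -/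
structure Direction (T : Triangulation M E) where
  lt : T.Vertex → T.Vertex → Prop
  ne_of_lt : ∀ {u v}, lt u v → u ≠ v
  isEdge_of_lt : ∀ {u v}, lt u v → T.IsEdge u v
  asymm : ∀ {u v}, lt u v → ¬ lt v u
  total : ∀ {u v}, u ≠ v → T.IsEdge u v → lt u v ∨ lt v u

namespace Direction

variable {T : Triangulation M E} (d : T.Direction)

/-- Oriented (increasing) edge paths in the `1`-skeleton with at least one edge. -/
inductive OrientedPath : T.Vertex → T.Vertex → Type _
  | single {u v : T.Vertex} (h : d.lt u v) : OrientedPath u v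
  | cons {u v w : T.Vertex} (h : d.lt u v) (p : OrientedPath v w) : OrientedPath u w

/-- The path in `M` which runs through the edges of an oriented edge path. -/
noncomputable def OrientedPath.toPath {d : T.Direction} :
    {u v : T.Vertex} → d.OrientedPath u v → Path (T.point u) (T.point v)
  | _, _, .single h => (d.isEdge_of_lt h).path
  | _, _, .cons h p => (d.isEdge_of_lt h).path.trans p.toPath

/-- Every oriented loop in the `1`-skeleton is homotopically essential in `M`. -/
def OrientedLoopsEssential : Prop :=
  ∀ (v : T.Vertex) (p : d.OrientedPath v v), ¬ p.toPath.Homotopic (Path.refl (T.point v))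

/-- The maximal subgraph `o(v)` of the link of `v` on the vertices to which an edge goes out
from `v`. -/
def outGraph (v : T.Vertex) :
    SimpleGraph ({w | d.lt v w.1} : Set {w : T.Vertex // w ≠ v ∧ T.IsEdge v w}) :=
  (T.linkGraph v).induce {w | d.lt v w.1}

/-- The maximal subgraph `i(v)` of the link of `v` on the vertices from which an edge comes in
to `v`. -/
def inGraph (v : T.Vertex) :
    SimpleGraph ({w | d.lt w.1 v} : Set {w : T.Vertex // w ≠ v ∧ T.IsEdge v w}) :=
  (T.linkGraph v).induce {w | d.lt w.1 v}

/-- Local orientations. (`SimpleGraph.Connected` includes that the graph is nonempty.) -/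
structure IsLocalOrientation : Prop where
  connected_out : ∀ v : T.Vertex, (d.outGraph v).Connected
  connected_in : ∀ v : T.Vertex, (d.inGraph v).Connected
  /-- The direction restricts to a total order on the vertices of each tetrahedron. -/
  total_order : ∀ s ∈ T.complex.faces, s.card = 4 →
    IsStrictTotalOrder {v : T.Vertex // v.1 ∈ s} (fun a b => d.lt a.1 b.1)
  /-- There is an increasing path from each vertex to each other vertex. -/
  recurrent : ∀ u v : T.Vertex, u ≠ v → Nonempty (d.OrientedPath u v)

/-- The edges of the triangulation, each given by its initial and terminal vertex. -/
structure Edge where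
  src : T.Vertex
  tgt : T.Vertex
  lt : d.lt src tgt

/-- The triangles of the triangulation whose vertices are totally ordered by the direction, in
the form `a < b < c`. -/
structure OrderedTriangle where
  a : T.Vertex
  b : T.Vertex
  c : T.Vertex
  isTriangle : T.IsTriangle a b c
  lt_ab : d.lt a b
  lt_bc : d.lt b c
  lt_ac : d.lt a c

namespace OrderedTriangle

variable {d : T.Direction} (t : d.OrderedTriangle)

def lower : d.Edge := ⟨t.a, t.b, t.lt_ab⟩

def upper : d.Edge := ⟨t.b, t.c, t.lt_bc⟩

def long : d.Edge := ⟨t.a, t.c, t.lt_ac⟩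

end OrderedTriangle

/-- The directed graph `Γ`: its vertices are the edges of the triangulation, with a directed edge
from the lower short edge, and one from the upper short edge, to the long edge of each triangle. -/
def Gamma : Digraph d.Edge where
  Adj e f := ∃ t : d.OrderedTriangle, (e = t.lower ∨ e = t.upper) ∧ f = t.long

/-- The directed edge `(e, f)` of a directed graph lies on a directed loop: it is an edge, and
some directed path leads from its end `f` back to its beginning `e`. -/
def _root_.Digraph.OnDirectedLoop {V : Type*} (G : Digraph V) (e f : V) : Prop :=
  G.Adj e f ∧ Relation.ReflTransGen G.Adj f e

/-- `Γ` is expanding: for some triangle, the directed edges of `Γ` from its upper and from its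
lower short edge to its long edge both lie on directed loops in `Γ`. -/
def IsExpanding : Prop :=
  ∃ t : d.OrderedTriangle,
    d.Gamma.OnDirectedLoop t.upper t.long ∧ d.Gamma.OnDirectedLoop t.lower t.long

end Direction

end Triangulation

/-! In a triangle the long edge is homotopic to the lower short edge followed by the upper one, so a
directed path in `Gamma` from `f` to `e` makes `e` homotopic to an oriented path through `f`
(`expands_of_reflTransGen`). For the long edge `k` of an expanding triangle, both short edges run
through `k` in this way, so `k ≃ f k g k h` with `f`, `g`, `h` classes of oriented, possibly
constant, edge paths. The loops `x = f` and `y = f k g` freely generate a free monoid: each product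
`u` of them is an initial segment of `k`, that is `k = u k r` with `r` oriented. Were a product
starting along `x` equal to one starting along `y`, cancelling `f` would give `u = k g v`, hence `k
r g v = 1`, a null-homotopic oriented loop (`OrientedLoopsEssential.isIndependentPair`). A free
monoid on two generators forces exponential growth once the group is known to be finitely generated,
which follows from compactness and local simple connectivity. -/

/-! ### Free submonoids and exponential growth -/

section Growth

variable {G : Type*} [Group G]

/-- No product of copies of `x` and `y` ending in `x` equals one ending in `y`. -/
def IsIndependentPair (x y : G) : Prop :=
  ∀ u ∈ Submonoid.closure {x, y}, ∀ v ∈ Submonoid.closure {x, y}, u * x ≠ v * y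

theorem IsIndependentPair.map {H : Type*} [Group H] {x y : G} (h : IsIndependentPair x y)
    (f : G ≃* H) : IsIndependentPair (f x) (f y) := by
  have himage : ({f x, f y} : Set H) = f.toMonoidHom '' {x, y} := by
    simp [Set.image_pair]
  intro u hu v hv huv
  rw [himage, ← MonoidHom.map_mclosure] at hu hv
  obtain ⟨u, hu, rfl⟩ := hu
  obtain ⟨v, hv, rfl⟩ := hv
  refine h u hu v hv (f.injective ?_)
  simpa using huv

open Classical in
-- Products ending in `x` are disjoint from those ending in `y`, so each further factor doubles the
-- count.
theorem IsIndependentPair.card_pow {x y : G} (h : IsIndependentPair x y) (n : ℕ) :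
    (({x, y} : Finset G) ^ n).card = 2 ^ n := by
  have hmem : ∀ (n : ℕ), ∀ u ∈ ({x, y} : Finset G) ^ n, u ∈ Submonoid.closure {x, y} := by
    intro n u hu
    have : u ∈ (({x, y} : Set G)) ^ n := by
      have := Finset.mem_coe.2 hu
      simpa using this
    exact Submonoid.pow_subset (Submonoid.subset_closure) this
  induction n with
  | zero => simp
  | succ n ih =>
    have hdisj : Disjoint ((({x, y} : Finset G) ^ n) * {x}) ((({x, y} : Finset G) ^ n) * {y}) := by
      rw [Finset.disjoint_left]
      intro g hx hy
      obtain ⟨u, hu, _, hx', rfl⟩ := Finset.mem_mul.1 hx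
      obtain ⟨v, hv, _, hy', huv⟩ := Finset.mem_mul.1 hy
      rw [Finset.mem_singleton] at hx' hy'
      subst hx' hy'
      exact h u (hmem n u hu) v (hmem n v hv) huv.symm
    have hsplit : ({x, y} : Finset G) = {x} ∪ {y} := rfl
    rw [pow_succ]
    conv_lhs => rw [hsplit, Finset.mul_union, ← hsplit]
    rw [Finset.card_union_of_disjoint hdisj]
    simp [ih, pow_succ, mul_two]

theorem wordBall_mono (S : Finset G) : Monotone (wordBall S) := by
  classical
  intro m n hmn
  unfold wordBall
  exact Finset.pow_subset_pow_right (Finset.mem_insert_self _ _) hmn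

theorem exists_mem_wordBall {S : Finset G} (hS : Subgroup.closure (S : Set G) = ⊤) (g : G) :
    ∃ n, g ∈ wordBall S n := by
  classical
  have hg : g ∈ (Subgroup.closure (S : Set G)).toSubmonoid := by simp [hS]
  rw [Subgroup.closure_toSubmonoid] at hg
  induction hg using Submonoid.closure_induction with
  | mem x hx =>
    refine ⟨1, ?_⟩
    simp only [wordBall, pow_one, Finset.mem_insert, Finset.mem_union, Finset.mem_inv']
    exact Or.inr (by simpa using hx)
  | one => exact ⟨0, by simp [wordBall]⟩
  | mul x y _ _ hx hy =>
    obtain ⟨m, hm⟩ := hx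
    obtain ⟨n, hn⟩ := hy
    refine ⟨m + n, ?_⟩
    unfold wordBall at *
    rw [pow_add]
    exact Finset.mul_mem_mul hm hn

theorem IsIndependentPair.hasExponentialGrowth [Group.FG G] {x y : G}
    (h : IsIndependentPair x y) : HasExponentialGrowth G := by
  classical
  refine ⟨inferInstance, fun S hS ↦ ?_⟩
  obtain ⟨k, hk, hxk, hyk⟩ : ∃ k, 0 < k ∧ x ∈ wordBall S k ∧ y ∈ wordBall S k := by
    obtain ⟨m, hm⟩ := exists_mem_wordBall hS x
    obtain ⟨n, hn⟩ := exists_mem_wordBall hS y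
    exact ⟨m + n + 1, by omega, wordBall_mono S (by omega) hm, wordBall_mono S (by omega) hn⟩
  have hcard (q : ℕ) : 2 ^ q ≤ (wordBall S (k * q)).card := by
    rw [← h.card_pow q]
    refine Finset.card_le_card ?_
    rw [wordBall, pow_mul]
    refine Finset.pow_subset_pow_left fun g hg ↦ ?_
    rcases Finset.mem_insert.1 hg with rfl | hg
    · exact hxk
    · rw [Finset.mem_singleton.1 hg]
      exact hyk
  have hball : 2 ≤ (wordBall S 1).card := by
    by_contra hlt
    have hone : wordBall S 1 = {1} := by
      refine (Finset.card_le_one_iff_subset_singleton.1 (by omega : (wordBall S 1).card ≤ 1)).elim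
        fun g hg ↦ ?_
      have h1 : (1 : G) ∈ wordBall S 1 := by simp [wordBall]
      have := Finset.mem_singleton.1 (hg h1)
      subst this
      exact Finset.Subset.antisymm hg (by simpa using h1)
    have hk1 : wordBall S k = {1} := by
      rw [wordBall, pow_one] at hone
      rw [wordBall, hone, Finset.singleton_pow, one_pow]
    have := hcard 1
    rw [mul_one, hk1] at this
    simp at this
  -- The factor 2 absorbs rounding: `n ≤ 2 * k * (n / k)` once `n ≥ k`. For `0 < n < k` the
  -- radius-one ball already has two elements, so `q = 1` serves.
  set c : ℝ := 2 ^ ((1 : ℝ) / (2 * k)) with hc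
  have hkpos : (0 : ℝ) < k := by exact_mod_cast hk
  refine ⟨c, Real.one_lt_rpow one_lt_two (by positivity), fun n ↦ ?_⟩
  have hcn : c ^ n = (2 : ℝ) ^ ((n : ℝ) / (2 * k)) := by
    rw [hc, ← Real.rpow_natCast, ← Real.rpow_mul zero_le_two]
    congr 1
    ring
  suffices H : ∃ q : ℕ, (n : ℝ) ≤ 2 * k * q ∧ 2 ^ q ≤ (wordBall S n).card by
    obtain ⟨q, hq, hle⟩ := H
    calc c ^ n ≤ (2 : ℝ) ^ (q : ℝ) := by
          rw [hcn]
          refine Real.rpow_le_rpow_of_exponent_le one_le_two ?_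
          rw [div_le_iff₀ (by positivity)]
          linarith
      _ = ((2 ^ q : ℕ) : ℝ) := by simp
      _ ≤ _ := by exact_mod_cast hle
  rcases Nat.eq_zero_or_pos n with rfl | hn
  · exact ⟨0, by simp, by simp [wordBall]⟩
  rcases lt_or_ge n k with hnk | hnk
  · refine ⟨1, ?_, hball.trans (Finset.card_le_card (wordBall_mono S hn))⟩
    have : (n : ℝ) ≤ k := by exact_mod_cast hnk.le
    push_cast
    linarith
  · refine ⟨n / k, ?_, (hcard _).trans (Finset.card_le_card (wordBall_mono S (Nat.mul_div_le n k)))⟩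
    have h1 : 1 ≤ n / k := Nat.div_pos hnk hk
    have h2 := Nat.div_add_mod n k
    have h3 := Nat.mod_lt n hk
    have : n ≤ 2 * k * (n / k) := by nlinarith
    exact_mod_cast this

end Growth

/-! ### Finite generation of the fundamental group -/

section FiniteGeneration

open CategoryTheory Topology

variable {X : Type*} [TopologicalSpace X]

/-- Any two paths in `U` with the same endpoints are homotopic in the ambient space. -/
def HomotopicPathsIn (U : Set X) : Prop :=
  ∀ ⦃x y : X⦄ (p q : Path x y), Set.range p ⊆ U → Set.range q ⊆ U → p.Homotopic q

theorem HomotopicPathsIn.mono {U V : Set X} (h : HomotopicPathsIn V) (hUV : U ⊆ V) :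
    HomotopicPathsIn U :=
  fun _ _ p q hp hq ↦ h p q (hp.trans hUV) (hq.trans hUV)

theorem IsSimplyConnected.homotopicPathsIn {U : Set X} (hU : IsSimplyConnected U) :
    HomotopicPathsIn U := by
  intro x y p q hp hq
  have := hU.simplyConnectedSpace
  have hx : x ∈ U := hp ⟨0, p.source⟩
  have hy : y ∈ U := hp ⟨1, p.target⟩
  let lift (r : Path x y) (hr : Set.range r ⊆ U) : Path (⟨x, hx⟩ : U) ⟨y, hy⟩ :=
    { toFun := fun t ↦ ⟨r t, hr ⟨t, rfl⟩⟩
      continuous_toFun := by fun_prop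
      source' := by simp
      target' := by simp }
  exact (SimplyConnectedSpace.paths_homotopic (lift p hp) (lift q hq)).map
    ⟨Subtype.val, continuous_subtype_val⟩

/-- A compact locally path connected metrizable space which is locally simply connected in the
weak sense of `HomotopicPathsIn` has a finite cover by path connected open sets such that paths in
the union of two overlapping members are determined by their endpoints up to homotopy. -/
theorem exists_finite_cover_homotopicPathsIn [CompactSpace X] [TopologicalSpace.MetrizableSpace X]
    [LocallyPathConnectedSpace X] (h : ∀ x : X, ∃ U ∈ 𝓝 x, HomotopicPathsIn U) :
    ∃ C : Set (Set X), C.Finite ∧ ⋃₀ C = Set.univ ∧ (∀ V ∈ C, IsOpen V ∧ IsPathConnected V) ∧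
      ∀ V ∈ C, ∀ W ∈ C, (V ∩ W).Nonempty → HomotopicPathsIn (V ∪ W) := by
  let := TopologicalSpace.metrizableSpaceMetric X
  choose U hU hUh using h
  obtain ⟨δ, hδ, hball⟩ := lebesgue_number_lemma_of_metric (s := (Set.univ : Set X))
    (c := fun x ↦ interior (U x)) isCompact_univ (fun _ ↦ isOpen_interior)
    (fun x _ ↦ Set.mem_iUnion.2 ⟨x, mem_interior_iff_mem_nhds.2 (hU x)⟩)
  -- With radius `δ / 4`, two overlapping members centred at `x` and `y` lie within `3δ / 4` of `x`,
  -- so inside one Lebesgue ball.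
  have hV (x : X) : ∃ V : Set X, IsOpen V ∧ IsPathConnected V ∧ x ∈ V ∧
      V ⊆ Metric.ball x (δ / 4) := by
    have hx : x ∈ Metric.ball x (δ / 4) := Metric.mem_ball_self (by positivity)
    exact ⟨_, Metric.isOpen_ball.pathComponentIn x, isPathConnected_pathComponentIn hx,
      mem_pathComponentIn_self hx, pathComponentIn_subset⟩
  choose V hVo hVc hxV hVb using hV
  obtain ⟨s, hs⟩ := isCompact_univ.elim_finite_subcover V hVo
    (fun x _ ↦ Set.mem_iUnion.2 ⟨x, hxV x⟩)
  refine ⟨V '' s, s.finite_toSet.image V, ?_, ?_, ?_⟩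
  · rw [Set.sUnion_image]
    exact Set.eq_univ_of_univ_subset hs
  · rintro _ ⟨x, -, rfl⟩
    exact ⟨hVo x, hVc x⟩
  · rintro _ ⟨x, -, rfl⟩ _ ⟨y, -, rfl⟩ ⟨z, hzx, hzy⟩
    obtain ⟨w, hw⟩ := hball x trivial
    refine (hUh w).mono (Set.Subset.trans ?_ (hw.trans interior_subset))
    have hzx := Metric.mem_ball.1 (hVb x hzx)
    have hzy := Metric.mem_ball.1 (hVb y hzy)
    rintro t (ht | ht)
    · have := Metric.mem_ball.1 (hVb x ht)
      exact Metric.mem_ball.2 (by linarith)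
    · have := Metric.mem_ball.1 (hVb y ht)
      have h1 := dist_triangle t y x
      have h2 := dist_triangle y z x
      rw [dist_comm y z] at h2
      exact Metric.mem_ball.2 (by linarith)

/-- The class of a path as a morphism of the fundamental groupoid. -/
abbrev Path.hom {x y : X} (p : Path x y) :
    FundamentalGroupoid.mk x ⟶ FundamentalGroupoid.mk y :=
  Path.Homotopic.Quotient.mk p

theorem Path.hom_trans {x y z : X} (p : Path x y) (q : Path y z) :
    (p.trans q).hom = p.hom ≫ q.hom := rfl

theorem Path.hom_symm {x y : X} (p : Path x y) : p.symm.hom = Groupoid.inv p.hom := rfl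

theorem Path.Homotopic.hom_eq {x y : X} {p q : Path x y} (h : p.Homotopic q) : p.hom = q.hom :=
  Path.Homotopic.Quotient.eq.2 h

theorem Path.hom_eq_iff {x y : X} {p q : Path x y} : p.hom = q.hom ↔ p.Homotopic q :=
  Path.Homotopic.Quotient.eq

theorem HomotopicPathsIn.trans_symm_hom_eq {V W : Set X} (h : HomotopicPathsIn (V ∪ W))
    {v w x y : X} {p : Path v x} {q : Path w x} {p' : Path v y} {q' : Path w y}
    (hp : Set.range p ⊆ V) (hq : Set.range q ⊆ W) (hp' : Set.range p' ⊆ V)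
    (hq' : Set.range q' ⊆ W) :
    p.hom ≫ Groupoid.inv q.hom = p'.hom ≫ Groupoid.inv q'.hom := by
  rw [← Path.hom_symm, ← Path.hom_symm, ← Path.hom_trans, ← Path.hom_trans]
  refine (h _ _ ?_ ?_).hom_eq <;> rw [Path.trans_range, Path.symm_range]
  · exact Set.union_subset_union hp hq
  · exact Set.union_subset_union hp' hq'

/-- The fundamental group of a compact, path connected, locally path connected metrizable space
is finitely generated if the space is locally simply connected. -/
theorem FundamentalGroup.fg_of_homotopicPathsIn [CompactSpace X]
    [TopologicalSpace.MetrizableSpace X] [LocallyPathConnectedSpace X] [PathConnectedSpace X]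
    (h : ∀ x : X, ∃ U ∈ 𝓝 x, HomotopicPathsIn U) (x₀ : X) : Group.FG (FundamentalGroup X x₀) := by
  obtain ⟨C, hC, hcover, hCV, hCP⟩ := exists_finite_cover_homotopicPathsIn h
  have hcov (x : X) : ∃ i : C, x ∈ i.1 := by
    obtain ⟨V, hV, hx⟩ := Set.mem_sUnion.1 (hcover ▸ Set.mem_univ x)
    exact ⟨⟨V, hV⟩, hx⟩
  have hoverlap (i j : C) {x : X} (hi : x ∈ i.1) (hj : x ∈ j.1) :
      HomotopicPathsIn (i.1 ∪ j.1) := hCP i i.2 j j.2 ⟨x, hi, hj⟩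
  choose v hv using fun i : C ↦ (hCV i i.2).2.nonempty
  have hpath (i : C) (x : X) (hx : x ∈ i.1) : ∃ p : Path (v i) x, Set.range p ⊆ i.1 := by
    obtain ⟨p, hp⟩ := (hCV i i.2).2.joinedIn _ (hv i) _ hx
    exact ⟨p, Set.range_subset_iff.2 hp⟩
  choose b hb using hpath
  let β (i : C) (x : X) (hx : x ∈ i.1) : FundamentalGroupoid.mk x₀ ⟶ FundamentalGroupoid.mk x :=
    (PathConnectedSpace.somePath x₀ (v i)).hom ≫ (b i x hx).hom
  -- One generator at most per pair of members: the loop through an overlap point `x` does not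
  -- depend on `x`.
  let S (ij : C × C) : Set (FundamentalGroup X x₀) :=
    {g | ∃ (x : X) (hi : x ∈ ij.1.1) (hj : x ∈ ij.2.1), g = β ij.1 x hi ≫ Groupoid.inv (β ij.2 x hj)}
  have hS (ij : C × C) : (S ij).Finite := by
    refine Set.Subsingleton.finite ?_
    rintro _ ⟨x, hi, hj, rfl⟩ _ ⟨y, hi', hj', rfl⟩
    have := (hoverlap ij.1 ij.2 hi hj).trans_symm_hom_eq (hb _ _ hi) (hb _ _ hj) (hb _ _ hi')
      (hb _ _ hj')
    simp only [Groupoid.inv_eq_inv] at this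
    simp only [β, Groupoid.inv_eq_inv, IsIso.inv_comp, Category.assoc]
    rw [reassoc_of% this]
  have : Finite C := hC
  set H : Subgroup (FundamentalGroup X x₀) := Subgroup.closure (⋃ ij, S ij) with hH
  -- Multiplication in `FundamentalGroup` is composition in reverse order.
  have hmul {f g : FundamentalGroup X x₀} (hf : f ∈ H) (hg : g ∈ H) :
      (show FundamentalGroup X x₀ from
        FundamentalGroup.toArrow f ≫ FundamentalGroup.toArrow g) ∈ H := H.mul_mem hg hf
  have hgen (i j : C) (x : X) (hi : x ∈ i.1) (hj : x ∈ j.1) :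
      (show FundamentalGroup X x₀ from β i x hi ≫ Groupoid.inv (β j x hj)) ∈ H :=
    Subgroup.subset_closure (Set.mem_iUnion.2 ⟨(i, j), x, hi, hj, rfl⟩)
  let Good {x y : X} (f : FundamentalGroupoid.mk x ⟶ FundamentalGroupoid.mk y) : Prop :=
    ∀ (i j : C) (hi : x ∈ i.1) (hj : y ∈ j.1),
      (show FundamentalGroup X x₀ from β i x hi ≫ f ≫ Groupoid.inv (β j y hj)) ∈ H
  have hgood_comp {x y z : X} {f : FundamentalGroupoid.mk x ⟶ FundamentalGroupoid.mk y}
      {g : FundamentalGroupoid.mk y ⟶ FundamentalGroupoid.mk z} (hf : Good f) (hg : Good g) :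
      Good (f ≫ g) := by
    intro i k hi hk
    obtain ⟨j, hj⟩ := hcov y
    have := hmul (hf i j hi hj) (hg j k hj hk)
    simpa using this
  have hgood_small {x y : X} (l : C) (p : Path x y) (hp : Set.range p ⊆ l.1) : Good p.hom := by
    intro i j hi hj
    have hx : x ∈ l.1 := hp ⟨0, p.source⟩
    have hy : y ∈ l.1 := hp ⟨1, p.target⟩
    have hmid : β l x hx ≫ p.hom = β l y hy := by
      simp only [β, Category.assoc]
      rw [← Path.hom_trans]
      congr 1
      refine (hoverlap l l hx hx _ _ ?_ ?_).hom_eq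
      · rw [Path.trans_range, Set.union_self]
        exact Set.union_subset (hb _ _ _) hp
      · rw [Set.union_self]
        exact hb _ _ _
    have := hmul (hgen i l x hi hx) (hgen l j y hy hj)
    rw [← hmid] at this
    simpa using this
  have hgood {x y : X} (p : Path x y) : Good p.hom := by
    have key : Good (p.subpath 0 1).hom := by
      -- Connectedness of the interval replaces a subdivision: short subpaths stay in one member of
      -- the cover, and goodness is transitive.
      refine PreconnectedSpace.induction₂' (fun s t ↦ Good (p.subpath s t).hom) ?_ ⟨?_⟩ 0 1
      · intro s
        obtain ⟨l, hl⟩ := hcov (p s)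
        have hopen : p ⁻¹' l.1 ∈ 𝓝 s :=
          p.continuous.continuousAt.preimage_mem_nhds ((hCV l l.2).1.mem_nhds hl)
        have hev : ∀ᶠ t in 𝓝 s, Set.uIcc s t ⊆ p ⁻¹' l.1 :=
          ((tendsto_const_nhds (x := s)).uIcc Filter.tendsto_id).eventually
            (Filter.eventually_smallSets_subset.2 hopen)
        filter_upwards [hev] with t ht
        constructor
        · refine hgood_small l _ ?_
          rw [Path.range_subpath]
          exact Set.image_subset_iff.2 ht
        · refine hgood_small l _ ?_
          rw [Path.range_subpath, Set.uIcc_comm]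
          exact Set.image_subset_iff.2 ht
      · intro r s t hrs hst
        have := hgood_comp hrs hst
        rwa [← Path.hom_trans, Path.hom_eq_iff.2 ⟨Path.Homotopy.subpathTransSubpath p r s t⟩] at this
    have hcast : ∀ {x' y' : X} (hx : x' = x) (hy : y' = y), Good (p.cast hx hy).hom → Good p.hom := by
      rintro _ _ rfl rfl h
      exact h
    rw [Path.subpath_zero_one] at key
    exact hcast p.source p.target key
  refine (Group.fg_iff).2 ⟨_, ?_, Set.finite_iUnion hS⟩
  rw [← hH, eq_top_iff]
  intro g _
  obtain ⟨i, hi⟩ := hcov x₀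
  have hall (f : FundamentalGroupoid.mk x₀ ⟶ FundamentalGroupoid.mk x₀) : Good f := by
    obtain ⟨p, rfl⟩ := Path.Homotopic.Quotient.mk_surjective f
    exact hgood p
  -- Conjugated so that the connecting paths in `Good` cancel and leave `g`.
  have := hall (Groupoid.inv (β i x₀ hi) ≫ FundamentalGroup.toArrow g ≫ β i x₀ hi) i i hi hi
  simpa using this

end FiniteGeneration

/-! ### Local simple connectivity of manifolds -/

section LocalTopology

open Topology

theorem OpenPartialHomeomorph.isSimplyConnected_symm_image {X Y : Type*} [TopologicalSpace X]
    [TopologicalSpace Y] (e : OpenPartialHomeomorph X Y) {s : Set Y} (hs : IsSimplyConnected s)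
    (hse : s ⊆ e.target) : IsSimplyConnected (e.symm '' s) := by
  have hemb : IsEmbedding (fun y : e.target ↦ e.symm y) := by
    have h : IsEmbedding (fun y : e.target ↦ (e.toHomeomorphSourceTarget.symm y : X)) :=
      IsEmbedding.subtypeVal.comp e.toHomeomorphSourceTarget.symm.isEmbedding
    exact h
  have himage : e.symm '' s = (fun y : e.target ↦ e.symm y) '' (Subtype.val ⁻¹' s) := by
    ext x
    constructor
    · rintro ⟨y, hy, rfl⟩
      exact ⟨⟨y, hse hy⟩, hy, rfl⟩
    · rintro ⟨y, hy, rfl⟩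
      exact ⟨y, hy, rfl⟩
  rw [himage, hemb.isSimplyConnected_image, ← IsEmbedding.subtypeVal.isSimplyConnected_image,
    Subtype.image_preimage_coe, Set.inter_eq_right.2 hse]
  exact hs

theorem Convex.isSimplyConnected {F : Type*} [AddCommGroup F] [Module ℝ F] [TopologicalSpace F]
    [IsTopologicalAddGroup F] [ContinuousSMul ℝ F] {s : Set F} (hs : Convex ℝ s)
    (hne : s.Nonempty) : IsSimplyConnected s := by
  have := hs.contractibleSpace hne
  exact SimplyConnectedSpace.ofContractible s

theorem ChartedSpace.exists_homotopicPathsIn {F X : Type*} [NormedAddCommGroup F]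
    [NormedSpace ℝ F] [TopologicalSpace X] [ChartedSpace F X] (x : X) :
    ∃ U ∈ 𝓝 x, HomotopicPathsIn U := by
  set e := chartAt F x
  have hx : x ∈ e.source := mem_chart_source F x
  obtain ⟨ε, hε, hball⟩ := Metric.isOpen_iff.1 e.open_target (e x) (e.map_source hx)
  refine ⟨e.symm '' Metric.ball (e x) ε, ?_, (e.isSimplyConnected_symm_image
    ((convex_ball _ _).isSimplyConnected (Metric.nonempty_ball.2 hε)) hball).homotopicPathsIn⟩
  refine (e.isOpen_image_symm_of_subset_target Metric.isOpen_ball hball).mem_nhds ?_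
  exact ⟨e x, Metric.mem_ball_self hε, e.left_inv hx⟩

end LocalTopology

/-! ### Oriented edge paths and the expanding triangle -/

namespace Triangulation

open CategoryTheory

variable {M : Type*} [TopologicalSpace M] {E : Type*} [NormedAddCommGroup E] [NormedSpace ℝ E]
  {T : Triangulation M E}

/-- A closed simplex is convex, hence simply connected. -/
theorem homotopicPathsIn_simplex {s : Finset E} (hs : s ∈ T.complex.faces) :
    HomotopicPathsIn (T.homeo '' (Subtype.val ⁻¹' convexHull ℝ (s : Set E))) := by
  refine IsSimplyConnected.homotopicPathsIn ?_
  rw [T.homeo.isSimplyConnected_image,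
    ← Topology.IsEmbedding.subtypeVal.isSimplyConnected_image, Subtype.image_preimage_coe,
    Set.inter_eq_right.2 (T.complex.convexHull_subset_space hs)]
  exact (convex_convexHull ℝ _).isSimplyConnected
    ((T.complex.nonempty_of_mem_faces hs).to_set.convexHull)

theorem IsEdge.range_path_subset {u v : T.Vertex} (h : T.IsEdge u v) {s : Set E} (hu : u.1 ∈ s)
    (hv : v.1 ∈ s) : Set.range h.path ⊆ T.homeo '' (Subtype.val ⁻¹' convexHull ℝ s) := by
  rintro _ ⟨t, rfl⟩
  refine ⟨⟨Path.segment u.1 v.1 t, h.lineMap_mem t⟩, ?_, rfl⟩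
  refine (convex_convexHull ℝ s).segment_subset (subset_convexHull ℝ s hu)
    (subset_convexHull ℝ s hv) ?_
  rw [← Path.range_segment]
  exact Set.mem_range_self t

theorem IsTriangle.path_trans_homotopic {a b c : T.Vertex} (h : T.IsTriangle a b c)
    (hab : T.IsEdge a b) (hbc : T.IsEdge b c) (hac : T.IsEdge a c) :
    hac.path.Homotopic (hab.path.trans hbc.path) := by
  classical
  unfold IsTriangle at h
  refine homotopicPathsIn_simplex h _ _ ?_ ?_
  · exact hac.range_path_subset (by simp) (by simp)
  · rw [Path.trans_range]
    exact Set.union_subset (hab.range_path_subset (by simp) (by simp))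
      (hbc.range_path_subset (by simp) (by simp))

theorem exists_vertex_joined (x : M) : ∃ v : T.Vertex, Joined x (T.point v) := by
  obtain ⟨y, rfl⟩ := T.homeo.surjective x
  obtain ⟨s, hs, hy⟩ := T.complex.mem_space_iff.1 y.2
  obtain ⟨v, hv⟩ := T.complex.nonempty_of_mem_faces hs
  have hvv : v ∈ T.complex.vertices :=
    T.complex.down_closed hs (Finset.singleton_subset_iff.2 hv) (Finset.singleton_nonempty v)
  refine ⟨⟨v, hvv⟩, ?_⟩
  have hjoin : JoinedIn T.complex.space y.1 v :=
    JoinedIn.of_segment_subset (((convex_convexHull ℝ _).segment_subset hy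
      (subset_convexHull ℝ _ hv)).trans (T.complex.convexHull_subset_space hs))
  exact ⟨hjoin.joined_subtype.somePath.map T.homeo.continuous⟩

namespace Direction

variable {d : T.Direction}

theorem IsLocalOrientation.pathConnectedSpace (h : d.IsLocalOrientation) [Nonempty M] :
    PathConnectedSpace M where
  nonempty := inferInstance
  joined x y := by
    obtain ⟨u, hu⟩ := T.exists_vertex_joined x
    obtain ⟨v, hv⟩ := T.exists_vertex_joined y
    refine hu.trans (Joined.trans ?_ hv.symm)
    rcases eq_or_ne u v with rfl | huv
    · exact Joined.refl _
    · obtain ⟨p⟩ := h.recurrent u v huv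
      exact ⟨p.toPath⟩

/-- A vertex as an object of the fundamental groupoid. -/
abbrev obj (v : T.Vertex) : FundamentalGroupoid M := ⟨T.point v⟩

/-- The class of an oriented edge in the fundamental groupoid. -/
def edgeHom {u v : T.Vertex} (h : d.lt u v) : obj u ⟶ obj v :=
  (d.isEdge_of_lt h).path.hom

/-- Classes of oriented edge paths, including the constant ones. -/
inductive Nonneg : ∀ {u v : T.Vertex}, (obj u ⟶ obj v) → Prop
  | id (u : T.Vertex) : Nonneg (𝟙 (obj u))
  | cons {u v w : T.Vertex} (h : d.lt u v) {f : obj v ⟶ obj w} (hf : Nonneg f) :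
      Nonneg (edgeHom h ≫ f)

theorem Nonneg.comp {u v w : T.Vertex} {f : obj u ⟶ obj v} {g : obj v ⟶ obj w}
    (hf : Nonneg (d := d) f) (hg : Nonneg (d := d) g) : Nonneg (d := d) (f ≫ g) := by
  induction hf with
  | id => simpa using hg
  | cons h _ ih =>
    rw [Category.assoc]
    exact .cons h (ih hg)

theorem nonneg_edgeHom {u v : T.Vertex} (h : d.lt u v) : Nonneg (d := d) (edgeHom h) := by
  simpa using Nonneg.cons h (.id v)

theorem Nonneg.exists_orientedPath {v w : T.Vertex} {f : obj v ⟶ obj w}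
    (hf : Nonneg (d := d) f) : ∀ {u : T.Vertex} (h : d.lt u v),
      ∃ p : d.OrientedPath u w, p.toPath.hom = edgeHom h ≫ f := by
  induction hf with
  | id => exact fun h ↦ ⟨.single h, by rw [Category.comp_id]; rfl⟩
  | cons h' _ ih =>
    intro u h
    obtain ⟨p, hp⟩ := ih h'
    exact ⟨.cons h p, by rw [← hp]; rfl⟩

/-- The leading edge guarantees positive length, since `Nonneg` admits constant paths. -/
theorem OrientedLoopsEssential.edgeHom_comp_ne_id (h : d.OrientedLoopsEssential) {u v : T.Vertex}
    (huv : d.lt u v) {f : obj v ⟶ obj u} (hf : Nonneg (d := d) f) : edgeHom huv ≫ f ≠ 𝟙 _ := by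
  intro heq
  obtain ⟨p, hp⟩ := hf.exists_orientedPath huv
  exact h u p (Path.hom_eq_iff.1 (hp.trans heq))

/-- The class of an edge of the triangulation in the fundamental groupoid. -/
abbrev Edge.hom (e : d.Edge) : obj e.src ⟶ obj e.tgt := edgeHom e.lt

theorem OrderedTriangle.hom_long (t : d.OrderedTriangle) :
    t.long.hom = t.lower.hom ≫ t.upper.hom :=
  (t.isTriangle.path_trans_homotopic _ _ _).hom_eq

/-- The edge `e` is homotopic to an oriented edge path that passes through `f`. -/
def Expands (e f : d.Edge) : Prop :=
  ∃ (g : obj e.src ⟶ obj f.src) (h : obj f.tgt ⟶ obj e.tgt),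
    Nonneg (d := d) g ∧ Nonneg (d := d) h ∧ e.hom = g ≫ f.hom ≫ h

theorem Expands.refl (e : d.Edge) : Expands e e :=
  ⟨𝟙 _, 𝟙 _, .id _, .id _, by simp⟩

theorem Expands.trans {e f k : d.Edge} (hef : Expands e f) (hfk : Expands f k) : Expands e k := by
  obtain ⟨g, h, hg, hh, heq⟩ := hef
  obtain ⟨g', h', hg', hh', heq'⟩ := hfk
  exact ⟨g ≫ g', h' ≫ h, hg.comp hg', hh'.comp hh, by simp [heq, heq']⟩

theorem expands_of_adj {e f : d.Edge} (h : d.Gamma.Adj f e) : Expands e f := by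
  obtain ⟨t, rfl | rfl, rfl⟩ := h
  · exact ⟨𝟙 _, t.upper.hom, .id _, nonneg_edgeHom _,
      t.hom_long.trans (Category.id_comp _).symm⟩
  · exact ⟨t.lower.hom, 𝟙 _, nonneg_edgeHom _, .id _,
      t.hom_long.trans (congrArg (t.lower.hom ≫ ·) (Category.comp_id _).symm)⟩

theorem expands_of_reflTransGen {e f : d.Edge} (h : Relation.ReflTransGen d.Gamma.Adj f e) :
    Expands e f := by
  induction h with
  | refl => exact .refl f
  | tail _ hadj ih => exact (expands_of_adj hadj).trans ih

/-- If an edge `k` is homotopic to an oriented edge path that passes through two copies of `k`,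
the initial segments of that path which end where the copies begin are independent. -/
theorem OrientedLoopsEssential.isIndependentPair (hess : d.OrientedLoopsEssential) {a b : T.Vertex}
    (hab : d.lt a b) {f : obj a ⟶ obj a} {g : obj b ⟶ obj a} {h : obj b ⟶ obj b}
    (hf : Nonneg (d := d) f) (hg : Nonneg (d := d) g) (hh : Nonneg (d := d) h)
    (heq : edgeHom hab = f ≫ edgeHom hab ≫ g ≫ edgeHom hab ≫ h) :
    IsIndependentPair (G := FundamentalGroup M (T.point a)) f (f ≫ edgeHom hab ≫ g) := by
  set k := edgeHom hab
  have hk : Nonneg (d := d) k := nonneg_edgeHom hab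
  -- Substituting one expansion of `k` into another keeps every product an initial segment of `k`.
  have key : ∀ u ∈ Submonoid.closure
      ({f, f ≫ k ≫ g} : Set (FundamentalGroup M (T.point a))),
      Nonneg (d := d) (u := a) (v := a) u ∧
        ∃ r : obj b ⟶ obj b, Nonneg (d := d) r ∧ k = FundamentalGroup.toArrow u ≫ k ≫ r := by
    intro u hu
    induction hu using Submonoid.closure_induction with
    | mem u hu =>
      rcases hu with rfl | rfl
      · exact ⟨hf, g ≫ k ≫ h, hg.comp (hk.comp hh), by simpa using heq⟩
      · exact ⟨hf.comp (hk.comp hg), h, hh, by simpa using heq⟩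
    | one => exact ⟨.id a, 𝟙 _, .id b, by rw [Category.comp_id]; exact (Category.id_comp k).symm⟩
    | mul u v _ _ hu hv =>
      obtain ⟨hu, r, hr, hur⟩ := hu
      obtain ⟨hv, s, hs, hvs⟩ := hv
      refine ⟨hv.comp hu, r ≫ s, hr.comp hs, ?_⟩
      change k = (FundamentalGroup.toArrow v ≫ FundamentalGroup.toArrow u) ≫ k ≫ r ≫ s
      calc k = FundamentalGroup.toArrow v ≫ k ≫ s := hvs
        _ = FundamentalGroup.toArrow v ≫ (FundamentalGroup.toArrow u ≫ k ≫ r) ≫ s := by rw [← hur]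
        _ = _ := by simp
  intro u hu v hv huv
  obtain ⟨-, r, hr, hur⟩ := key u hu
  obtain ⟨hv, -⟩ := key v hv
  set u' : obj a ⟶ obj a := u
  set v' : obj a ⟶ obj a := v
  have huv' : f ≫ u' = (f ≫ k ≫ g) ≫ v' := huv
  rw [Category.assoc, cancel_epi, Category.assoc] at huv'
  have hloop : (g ≫ v') ≫ (k ≫ r) = 𝟙 _ := by
    have : k ≫ (g ≫ v') ≫ (k ≫ r) = k ≫ 𝟙 _ := by
      rw [Category.comp_id]
      conv_rhs => rw [show k = u' ≫ k ≫ r from hur, huv']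
      simp
    exact (cancel_epi k).1 this
  -- The trivial loop is rotated to start with the edge `k`.
  refine hess.edgeHom_comp_ne_id hab (hr.comp (hg.comp hv)) ?_
  change k ≫ r ≫ g ≫ v' = 𝟙 _
  have hinv := IsIso.eq_inv_of_hom_inv_id hloop
  rw [← Category.assoc, hinv]
  simp

theorem IsExpanding.exists_isIndependentPair (hexp : d.IsExpanding)
    (hess : d.OrientedLoopsEssential) :
    ∃ (v : T.Vertex) (x y : FundamentalGroup M (T.point v)), IsIndependentPair x y := by
  obtain ⟨t, ⟨-, hupper⟩, -, hlower⟩ := hexp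
  obtain ⟨f, f', hf, hf', hlow⟩ := expands_of_reflTransGen hlower
  obtain ⟨g, h, hg, hh, hup⟩ := expands_of_reflTransGen hupper
  -- The middle segment between the two copies of the long edge is the end of the lower expansion
  -- followed by the start of the upper one.
  refine ⟨t.a, _, _, hess.isIndependentPair t.lt_ac hf (hf'.comp hg) hh ?_⟩
  have := t.hom_long
  rw [hlow, hup] at this
  have hassoc : ∀ (k : obj t.a ⟶ obj t.c) (f : obj t.a ⟶ obj t.a) (f' : obj t.c ⟶ obj t.b)
      (g : obj t.b ⟶ obj t.a) (h : obj t.c ⟶ obj t.c),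
      (f ≫ k ≫ f') ≫ g ≫ k ≫ h = f ≫ k ≫ (f' ≫ g) ≫ k ≫ h := by
    intros
    simp only [Category.assoc]
  exact this.trans (hassoc _ _ _ _ _)

end Direction

end Triangulation

theorem lemma4p1 {M : Type*} [TopologicalSpace M] [T2Space M] [CompactSpace M]
    [ChartedSpace (EuclideanSpace ℝ (Fin 3)) M]
    {E : Type*} [NormedAddCommGroup E] [NormedSpace ℝ E]
    (T : Triangulation M E) (d : T.Direction)
    (hlocal : d.IsLocalOrientation) (hessential : d.OrientedLoopsEssential)
    (hexpanding : d.IsExpanding) (x : M) :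
    HasExponentialGrowth (FundamentalGroup M x) := by
  have : Nonempty M := ⟨x⟩
  have := hlocal.pathConnectedSpace
  have : LocallyPathConnectedSpace M :=
    ChartedSpace.locallyPathConnectedSpace (EuclideanSpace ℝ (Fin 3)) M
  have : TopologicalSpace.MetrizableSpace M := T.homeo.symm.isEmbedding.metrizableSpace
  have := FundamentalGroup.fg_of_homotopicPathsIn
    (ChartedSpace.exists_homotopicPathsIn (F := EuclideanSpace ℝ (Fin 3)) (X := M)) x
  obtain ⟨v, f, g, hfg⟩ := hexpanding.exists_isIndependentPair hessential
  exact (hfg.map (FundamentalGroup.fundamentalGroupMulEquivOfPathConnected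
    (T.point v) x)).hasExponentialGrowth
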